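/- Online $b$-matching with stochastic rewards. Fix an integer $b\ge 1$. A finite set $S$ of servers, each of capacity $b$, is known in advance. Requests arrive one by one; on arrival, the set of servers adjacent to the request and the success probabilities $p_{s,r}\in[0,1]$ of its edges are revealed. The algorithm immediately and irrevocably assigns the request to an adjacent server that has so far been matched fewer than $b$ times, or leaves it unassigned. An assignment of $r$ to $s$ becomes a match with probability $p_{s,r}$, independently of the past, and the algorithm learns the outcome only afterwards; an unsuccessful assignment uses no capacity. The decisions of a randomized online algorithm $\mathrm{Alg}$ depend only on its random seed, on the servers and $b$, and on the requests and outcomes seen so far. Let $\mathbb{E}[\mathrm{Alg}(G)]$ be its expected number of matches on the input graph $G$ (with its arrival order). Let $\mathrm{SOpt}(G)$, the stochastic (clairvoyant) benchmark, be the largest expected number of matches on $G$ of an algorithm that knows $G$ and all edge probabilities in advance, but serves the requests in their order of arrival and learns the outcome of an assignment only after making it. **Theorem.** For every $b\ge 1$, no randomized online algorithm has a competitive ratio greater than $1-1/e$ against $\mathrm{SOpt}$, even for equal and vanishing edge probabilities. Precisely: for every integer $b\ge1$ and every real $c>1-1/e$ there are $n\in\mathbb{N}$ and $p_0>0$ such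 that, for every $p\in(0,1]$ with $p\le p_0$ and every randomized online algorithm $\mathrm{Alg}$ (which may be designed for $n$, $b$ and $p$), there is an input graph $G$ with $n$ servers, all of whose edges have success probability $p$, such that $$\mathbb{E}[\mathrm{Alg}(G)] < c\cdot \mathrm{SOpt}(G).$$ -/

import Mathlib

open MeasureTheory
open scoped ENNReal

universe u

namespace StochasticBMatching

/-- A request, described by what is revealed on its arrival: `r s = none` if the request is not
adjacent to the server `s`, and `r s = some p` if there is an edge to `s` with success
probability `p`. -/
abbrev Request (S : Type) : Type := S → Option unitInterval

/-- An input graph on the server set `S`: the requests in their order of arrival. -/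
abbrev Instance (S : Type) : Type := List (Request S)

/-- What an algorithm has seen of one processed request: the request and the assignment, which is
`none` if the request stayed unassigned, `some (s, true)` if it was assigned to `s` and accepted
(a match), and `some (s, false)` if it was assigned to `s` and did not accept. -/
structure Step (S : Type) where
  request : Request S
  assignment : Option (S × Bool)

/-- The processed requests, most recent one first. -/
abbrev History (S : Type) : Type := List (Step S)

open Classical in
/-- The number of (successful) matches of the server `s`. -/
noncomputable def matchesOf {S : Type} (h : History S) (s : S) : ℕ :=
  h.countP fun st => decide (st.assignment = some (s, true))

/-- The total number of matches. -/
noncomputable def totalMatches {S : Type} [Fintype S] (h : History S) : ℕ :=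
  ∑ s, matchesOf h s

/-- A deterministic decision rule for servers of capacity `b`. Given the history and the arriving
request it either leaves the request unassigned or assigns it to an adjacent server with remaining
capacity. The outcome of an assignment is only known afterwards, as a part of the history. -/
structure Policy (S : Type) (b : ℕ) where
  choose : History S → Request S → Option S
  feasible : ∀ h r s, choose h r = some s → r s ≠ none ∧ matchesOf h s < b

/-- A biased coin: `true` with probability `p` and `false` with probability `1 - p`. -/
noncomputable def coin (p : unitInterval) : PMF Bool :=
  PMF.ofFintype
    (fun ok => if ok then ENNReal.ofReal (p : ℝ) else ENNReal.ofReal (1 - (p : ℝ))) (by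
      rw [Fintype.sum_bool, if_pos rfl, if_neg Bool.false_ne_true,
        ← ENNReal.ofReal_add p.2.1 (sub_nonneg.2 p.2.2), add_sub_cancel, ENNReal.ofReal_one])

/-- The law of the final history when the policy starts with history `h` and then serves the given
requests in their order. Every assignment succeeds with the probability of its edge, independently
of the past. -/
noncomputable def Policy.run {S : Type} {b : ℕ} (A : Policy S b) :
    History S → Instance S → PMF (History S)
  | h, [] => PMF.pure h
  | h, r :: rs =>
    match A.choose h r with
    | none => A.run (⟨r, none⟩ :: h) rs
    | some s =>
      (coin ((r s).getD 0)).bind fun ok => A.run (⟨r, some (s, ok)⟩ :: h) rs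

/-- The expected number of matches of a policy on `G`. -/
noncomputable def Policy.expectedMatches {S : Type} [Fintype S] {b : ℕ} (A : Policy S b)
    (G : Instance S) : ℝ≥0∞ :=
  ∑' h, A.run [] G h * (totalMatches h : ℝ≥0∞)

/-- The stochastic (clairvoyant) benchmark: the largest expected number of matches on `G` of a
policy. The graph `G` is fixed before the policy is picked, so the policy may depend on all of `G`,
but it serves the requests in their order of arrival and learns the outcome of an assignment only
after making it. -/
noncomputable def SOpt {S : Type} [Fintype S] (b : ℕ) (G : Instance S) : ℝ≥0∞ :=
  ⨆ A : Policy S b, A.expectedMatches G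

/-- A randomized online algorithm for the server set `S` and capacity `b`: a policy that depends
on a random seed, drawn from an arbitrary probability space. It decides on a request from the seed,
the servers, the capacity, the requests so far and their outcomes only. -/
structure RandomizedAlgorithm (S : Type) (b : ℕ) where
  Ω : Type u
  [measurableSpace : MeasurableSpace Ω]
  μ : Measure Ω
  [isProbabilityMeasure : IsProbabilityMeasure μ]
  policy : Ω → Policy S b
  measurable_choose : ∀ h r d, MeasurableSet {ω | (policy ω).choose h r = d}

/-- The expected number of matches, over the seed and the outcomes of the assignments. -/
noncomputable def RandomizedAlgorithm.expectedMatches {S : Type} [Fintype S] {b : ℕ}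
    (A : RandomizedAlgorithm.{u} S b) (G : Instance S) : ℝ≥0∞ :=
  letI := A.measurableSpace
  ∫⁻ ω, (A.policy ω).expectedMatches G ∂A.μ

/-- `A` is `c`-competitive against the stochastic benchmark on the class `𝒢` of input graphs. -/
def RandomizedAlgorithm.IsCompetitiveOn {S : Type} [Fintype S] {b : ℕ}
    (A : RandomizedAlgorithm.{u} S b) (c : ℝ) (𝒢 : Set (Instance S)) : Prop :=
  ∀ G ∈ 𝒢, ENNReal.ofReal c * SOpt b G ≤ A.expectedMatches G

/-- The input graphs on `S` all of whose edges have success probability `p`. -/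
def equalProbability (S : Type) (p : unitInterval) : Set (Instance S) :=
  {G | ∀ r ∈ G, ∀ s q, r s = some q → q = p}

end StochasticBMatching

/-! Split the servers into `k` groups of `m`, each of total capacity `M = m * b`, and let the
requests come in `k` phases of `N = ⌊M / p⌋` equal requests. A phase is adjacent to the groups that
are still present, and one group is dropped after each phase. This is the upper-triangular instance
of online matching with groups in place of single vertices.

The benchmark knows the dropping order and serves each phase by the group about to be dropped. That
group gains the mean of a binomial variable truncated at `M`, which is at least `M - 1 - √M / 2`.
Pooling `m` servers is what handles small `b`: truncation costs a constant fraction of a single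
server's capacity, but a vanishing fraction of `M` as `m` grows (`le_truncatedMean_floor`,
`length_mul_truncatedMean_le_SOpt`).

Against a given algorithm, the group dropped is one of least mean load among those present. A phase
brings at most `N * p ≤ M` expected matches, so the algorithm does no better than spreading each
phase evenly: the groups dropped in the first `t` phases collect at most `M * (t - (k - t) * H)` in
total, where `H = ∑ j < t, 1 / (k - j)` (`exists_phases_sum_meanLoad_le`). The other `k - t` groups
are bounded by their capacity, which gives `M * (k - (k - t) * H)`. With `k - t ≈ k / e` one has `H
≈ 1`, and the ratio tends to `1 - 1/e`. The adversary uses only mean loads, not realized outcomes,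
so the input is a fixed graph even for a randomized algorithm. -/

namespace StochasticBMatching

/-! ### Bookkeeping of loads. -/

section Histories

variable {S : Type}

theorem matchesOf_nil (s : S) : matchesOf [] s = 0 := rfl

theorem matchesOf_cons_none (r : Request S) (h : History S) (s : S) :
    matchesOf (⟨r, none⟩ :: h) s = matchesOf h s := by
  simp [matchesOf]

theorem matchesOf_cons_false (r : Request S) (h : History S) (s' s : S) :
    matchesOf (⟨r, some (s', false)⟩ :: h) s = matchesOf h s := by
  simp [matchesOf]

open Classical in
theorem matchesOf_cons_true (r : Request S) (h : History S) (s' s : S) :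
    matchesOf (⟨r, some (s', true)⟩ :: h) s = matchesOf h s + if s' = s then 1 else 0 := by
  simp [matchesOf, List.countP_cons]

/-- The number of matches of the servers in `W`. -/
noncomputable def load (W : Finset S) (h : History S) : ℕ := ∑ s ∈ W, matchesOf h s

theorem totalMatches_eq_load [Fintype S] (h : History S) :
    totalMatches h = load Finset.univ h := rfl

theorem load_nil (W : Finset S) : load W [] = 0 := by simp [load, matchesOf_nil]

theorem load_cons_none (W : Finset S) (r : Request S) (h : History S) :
    load W (⟨r, none⟩ :: h) = load W h := by
  simp [load, matchesOf_cons_none]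

theorem load_cons_false (W : Finset S) (r : Request S) (h : History S) (s : S) :
    load W (⟨r, some (s, false)⟩ :: h) = load W h := by
  simp [load, matchesOf_cons_false]

open Classical in
theorem load_cons_true (W : Finset S) (r : Request S) (h : History S) (s : S) :
    load W (⟨r, some (s, true)⟩ :: h) = load W h + if s ∈ W then 1 else 0 := by
  simp [load, matchesOf_cons_true, Finset.sum_add_distrib]

end Histories

/-! ### Expectations under a policy, as a real-valued recursion. -/

section Value

variable {S : Type} {b : ℕ}

/-- The expectation of `F` at the final history when the policy starts with history `h` and then
serves the given requests. -/
noncomputable def Policy.value (A : Policy S b) (F : History S → ℝ) :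
    History S → Instance S → ℝ
  | h, [] => F h
  | h, r :: rs =>
    match A.choose h r with
    | none => A.value F (⟨r, none⟩ :: h) rs
    | some s =>
      (((r s).getD 0 : unitInterval) : ℝ) * A.value F (⟨r, some (s, true)⟩ :: h) rs +
        (1 - (((r s).getD 0 : unitInterval) : ℝ)) * A.value F (⟨r, some (s, false)⟩ :: h) rs

theorem Policy.value_cons_none (A : Policy S b) (F : History S → ℝ) {h : History S}
    {r : Request S} (hc : A.choose h r = none) (rs : Instance S) :
    A.value F h (r :: rs) = A.value F (⟨r, none⟩ :: h) rs := by
  rw [Policy.value, hc]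

theorem Policy.value_cons_some (A : Policy S b) (F : History S → ℝ) {h : History S}
    {r : Request S} {s : S} {q : unitInterval} (hc : A.choose h r = some s) (hq : r s = some q)
    (rs : Instance S) :
    A.value F h (r :: rs) = (q : ℝ) * A.value F (⟨r, some (s, true)⟩ :: h) rs +
      (1 - (q : ℝ)) * A.value F (⟨r, some (s, false)⟩ :: h) rs := by
  rw [Policy.value, hc]
  simp [hq]

theorem Policy.exists_prob (A : Policy S b) {h : History S} {r : Request S} {s : S}
    (hc : A.choose h r = some s) : ∃ q, r s = some q :=
  Option.ne_none_iff_exists'.1 (A.feasible h r s hc).1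

theorem Policy.value_nonneg (A : Policy S b) {F : History S → ℝ} (hF : ∀ h, 0 ≤ F h)
    (G : Instance S) (h : History S) : 0 ≤ A.value F h G := by
  induction G generalizing h with
  | nil => exact hF h
  | cons r rs ih =>
    cases hc : A.choose h r with
    | none => rw [A.value_cons_none F hc]; exact ih _
    | some s =>
      obtain ⟨q, hq⟩ := A.exists_prob hc
      rw [A.value_cons_some F hc hq]
      exact add_nonneg (mul_nonneg q.2.1 (ih _)) (mul_nonneg (sub_nonneg.2 q.2.2) (ih _))

theorem Policy.tsum_run_mul_ofReal (A : Policy S b) {F : History S → ℝ} (hF : ∀ h, 0 ≤ F h)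
    (G : Instance S) (h : History S) :
    ∑' h', A.run h G h' * ENNReal.ofReal (F h') = ENNReal.ofReal (A.value F h G) := by
  induction G generalizing h with
  | nil =>
    rw [tsum_eq_single h]
    · simp [Policy.run, Policy.value]
    · intro h' hne
      simp [Policy.run, PMF.pure_apply, hne]
  | cons r rs ih =>
    cases hc : A.choose h r with
    | none =>
      rw [A.value_cons_none F hc, ← ih]
      simp [Policy.run, hc]
    | some s =>
      obtain ⟨q, hq⟩ := A.exists_prob hc
      have h1 := A.value_nonneg hF rs (⟨r, some (s, true)⟩ :: h)
      have h2 := A.value_nonneg hF rs (⟨r, some (s, false)⟩ :: h)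
      rw [A.value_cons_some F hc hq, ENNReal.ofReal_add (mul_nonneg q.2.1 h1)
        (mul_nonneg (sub_nonneg.2 q.2.2) h2), ENNReal.ofReal_mul q.2.1,
        ENNReal.ofReal_mul (sub_nonneg.2 q.2.2), ← ih, ← ih, ← ENNReal.tsum_mul_left,
        ← ENNReal.tsum_mul_left, ← ENNReal.tsum_add]
      refine tsum_congr fun h' => ?_
      simp [Policy.run, hc, hq, PMF.bind_apply, coin, add_mul, mul_assoc]

theorem Policy.expectedMatches_eq_ofReal_value [Fintype S] (A : Policy S b) (G : Instance S) :
    A.expectedMatches G = ENNReal.ofReal (A.value (fun h => (load Finset.univ h : ℝ)) [] G) := by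
  rw [← A.tsum_run_mul_ofReal (fun h => Nat.cast_nonneg _)]
  simp [Policy.expectedMatches, totalMatches_eq_load]

theorem Policy.value_append (A : Policy S b) (F : History S → ℝ) (G₁ G₂ : Instance S)
    (h : History S) :
    A.value F h (G₁ ++ G₂) = A.value (fun h' => A.value F h' G₂) h G₁ := by
  induction G₁ generalizing h with
  | nil => rfl
  | cons r rs ih =>
    rw [List.cons_append]
    cases hc : A.choose h r with
    | none => rw [A.value_cons_none _ hc, A.value_cons_none _ hc, ih]
    | some s =>
      obtain ⟨q, hq⟩ := A.exists_prob hc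
      rw [A.value_cons_some _ hc hq, A.value_cons_some _ hc hq, ih, ih]

theorem Policy.value_sum (A : Policy S b) {ι : Type*} (t : Finset ι) (F : ι → History S → ℝ)
    (G : Instance S) (h : History S) :
    A.value (fun h' => ∑ i ∈ t, F i h') h G = ∑ i ∈ t, A.value (F i) h G := by
  induction G generalizing h with
  | nil => rfl
  | cons r rs ih =>
    cases hc : A.choose h r with
    | none => simp only [A.value_cons_none _ hc, ih]
    | some s =>
      obtain ⟨q, hq⟩ := A.exists_prob hc
      simp only [A.value_cons_some _ hc hq, ih, Finset.mul_sum, Finset.sum_add_distrib]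

/-- Later requests cannot change the load of servers that they do not see; this freezes the load of
a dropped group. -/
theorem Policy.value_load_of_not_adjacent (A : Policy S b) (W : Finset S) {G : Instance S}
    (hG : ∀ r ∈ G, ∀ s ∈ W, r s = none) (h : History S) :
    A.value (fun h' => (load W h' : ℝ)) h G = load W h := by
  induction G generalizing h with
  | nil => rfl
  | cons r rs ih =>
    have ih' := ih fun r' hr' => hG r' (List.mem_cons_of_mem _ hr')
    cases hc : A.choose h r with
    | none => rw [A.value_cons_none _ hc, ih', load_cons_none]
    | some s =>
      obtain ⟨q, hq⟩ := A.exists_prob hc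
      have hs : s ∉ W := fun hs => by simp [hG r List.mem_cons_self s hs] at hq
      rw [A.value_cons_some _ hc hq, ih', ih', load_cons_false, load_cons_true, if_neg hs]
      push_cast
      ring

-- Each request yields a match with probability at most `p`, whatever the policy does.
open Classical in
theorem Policy.value_load_le (A : Policy S b) (W : Finset S) (p : unitInterval) {G : Instance S}
    (hG : G ∈ equalProbability S p) (h : History S) :
    A.value (fun h' => (load W h' : ℝ)) h G ≤ load W h + G.length * (p : ℝ) := by
  induction G generalizing h with
  | nil => simp [Policy.value]
  | cons r rs ih =>
    have ih' := ih fun r' hr' => hG r' (List.mem_cons_of_mem _ hr')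
    have hp := p.2.1
    have hp' := sub_nonneg.2 p.2.2
    rw [List.length_cons]
    push_cast
    cases hc : A.choose h r with
    | none =>
      have := ih' (⟨r, none⟩ :: h)
      rw [load_cons_none] at this
      rw [A.value_cons_none _ hc]
      linarith
    | some s =>
      obtain ⟨q, hq⟩ := A.exists_prob hc
      obtain rfl := hG r List.mem_cons_self s q hq
      have h1 := ih' (⟨r, some (s, true)⟩ :: h)
      have h2 := ih' (⟨r, some (s, false)⟩ :: h)
      rw [load_cons_true] at h1
      rw [load_cons_false] at h2
      rw [A.value_cons_some _ hc hq]
      have h3 : ((load W h + if s ∈ W then 1 else 0 : ℕ) : ℝ) ≤ load W h + 1 := by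
        push_cast
        split_ifs <;> norm_num
      have h4 := mul_le_mul_of_nonneg_left (h1.trans (add_le_add_left h3 _)) hp
      have h5 := mul_le_mul_of_nonneg_left h2 hp'
      linarith

theorem Policy.value_matchesOf_le (A : Policy S b) (s : S) (G : Instance S) {h : History S}
    (hh : matchesOf h s ≤ b) : A.value (fun h' => (matchesOf h' s : ℝ)) h G ≤ b := by
  induction G generalizing h with
  | nil =>
    rw [Policy.value]
    exact_mod_cast hh
  | cons r rs ih =>
    cases hc : A.choose h r with
    | none =>
      rw [A.value_cons_none _ hc]
      exact ih (by rwa [matchesOf_cons_none])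
    | some s' =>
      obtain ⟨q, hq⟩ := A.exists_prob hc
      rw [A.value_cons_some _ hc hq]
      have hcap := (A.feasible h r s' hc).2
      have h1 := ih (h := ⟨r, some (s', true)⟩ :: h) (by
        rw [matchesOf_cons_true]
        split_ifs with he
        · subst he; omega
        · simpa using hh)
      have h2 := ih (h := ⟨r, some (s', false)⟩ :: h) (by rwa [matchesOf_cons_false])
      have h3 := mul_le_mul_of_nonneg_left h1 q.2.1
      have h4 := mul_le_mul_of_nonneg_left h2 (sub_nonneg.2 q.2.2)
      linarith

theorem Policy.value_load_le_card_mul (A : Policy S b) (W : Finset S) (G : Instance S) :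
    A.value (fun h' => (load W h' : ℝ)) [] G ≤ W.card * b := by
  simp only [load, Nat.cast_sum]
  rw [A.value_sum W (fun s h => (matchesOf h s : ℝ))]
  refine (Finset.sum_le_card_nsmul _ _ (b : ℝ) fun s _ => A.value_matchesOf_le s G ?_).trans ?_
  · simp [matchesOf_nil]
  · simp

end Value

/-! ### Averaging over the random seed. -/

section Randomized

variable {S : Type} {b : ℕ}

theorem measurable_value [Finite S] {Ω : Type u} [MeasurableSpace Ω] (P : Ω → Policy S b)
    (hP : ∀ h r d, MeasurableSet {ω | (P ω).choose h r = d}) (F : History S → ℝ)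
    (G : Instance S) (h : History S) : Measurable fun ω => (P ω).value F h G := by
  classical
  cases nonempty_fintype S
  induction G generalizing h with
  | nil => exact measurable_const
  | cons r rs ih =>
    let V : Option S → Ω → ℝ := fun d ω => match d with
      | none => (P ω).value F (⟨r, none⟩ :: h) rs
      | some s => (((r s).getD 0 : unitInterval) : ℝ) *
          (P ω).value F (⟨r, some (s, true)⟩ :: h) rs +
        (1 - (((r s).getD 0 : unitInterval) : ℝ)) *
          (P ω).value F (⟨r, some (s, false)⟩ :: h) rs
    have hV : ∀ d, Measurable (V d) := by
      rintro (_ | s)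
      · exact ih _
      · exact ((ih _).const_mul _).add ((ih _).const_mul _)
    -- Measurability is assumed only for the events that a given choice is made, so the seeds are
    -- split by the finitely many choices.
    have heq : (fun ω => (P ω).value F h (r :: rs)) =
        fun ω => ∑ d, if (P ω).choose h r = d then V d ω else 0 := by
      funext ω
      rw [Finset.sum_ite_eq Finset.univ ((P ω).choose h r), if_pos (Finset.mem_univ _),
        Policy.value]
    rw [heq]
    exact Finset.measurable_sum _ fun d _ => Measurable.ite (hP h r d) (hV d) measurable_const

/-- The expected number of matches of the servers in `W`. -/
noncomputable def RandomizedAlgorithm.meanLoad (A : RandomizedAlgorithm.{u} S b) (W : Finset S)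
    (G : Instance S) : ℝ :=
  letI := A.measurableSpace
  ∫ ω, (A.policy ω).value (fun h => (load W h : ℝ)) [] G ∂A.μ

variable (A : RandomizedAlgorithm.{u} S b)

/-- The total capacity bounds the integrand. Integrability lets the mean loads be added and compared
as real numbers. -/
theorem RandomizedAlgorithm.integrable_value_load [Finite S] (W : Finset S) (G : Instance S) :
    letI := A.measurableSpace
    Integrable (fun ω => (A.policy ω).value (fun h => (load W h : ℝ)) [] G) A.μ := by
  let := A.measurableSpace
  have := A.isProbabilityMeasure
  refine Integrable.of_bound (C := W.card * b)
    (measurable_value A.policy A.measurable_choose _ G []).aestronglyMeasurable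
    (Filter.Eventually.of_forall fun ω => ?_)
  rw [Real.norm_of_nonneg (Policy.value_nonneg _ (fun h => Nat.cast_nonneg _) _ _)]
  exact (A.policy ω).value_load_le_card_mul W G

theorem RandomizedAlgorithm.expectedMatches_eq_ofReal_meanLoad [Fintype S] (G : Instance S) :
    A.expectedMatches G = ENNReal.ofReal (A.meanLoad Finset.univ G) := by
  let := A.measurableSpace
  rw [meanLoad, ofReal_integral_eq_lintegral_ofReal (A.integrable_value_load _ G)
    (Filter.Eventually.of_forall fun ω =>
      Policy.value_nonneg _ (fun h => Nat.cast_nonneg _) _ _)]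
  simp only [expectedMatches, Policy.expectedMatches_eq_ofReal_value]

theorem RandomizedAlgorithm.meanLoad_nonneg (W : Finset S) (G : Instance S) :
    0 ≤ A.meanLoad W G := by
  let := A.measurableSpace
  exact integral_nonneg fun ω => Policy.value_nonneg _ (fun h => Nat.cast_nonneg _) _ _

theorem RandomizedAlgorithm.meanLoad_le_of_forall [Finite S] (W : Finset S) (G : Instance S)
    {C : ℝ} (hC : ∀ ω, (A.policy ω).value (fun h => (load W h : ℝ)) [] G ≤ C) :
    A.meanLoad W G ≤ C := by
  let := A.measurableSpace
  have := A.isProbabilityMeasure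
  refine (integral_mono (A.integrable_value_load W G) (integrable_const C) hC).trans ?_
  simp

theorem RandomizedAlgorithm.meanLoad_le_card_mul [Finite S] (W : Finset S) (G : Instance S) :
    A.meanLoad W G ≤ W.card * b :=
  A.meanLoad_le_of_forall W G fun ω => (A.policy ω).value_load_le_card_mul W G

theorem RandomizedAlgorithm.meanLoad_le_length_mul [Finite S] (W : Finset S) {p : unitInterval}
    {G : Instance S} (hG : G ∈ equalProbability S p) :
    A.meanLoad W G ≤ G.length * (p : ℝ) :=
  A.meanLoad_le_of_forall W G fun ω => by
    simpa [load_nil] using (A.policy ω).value_load_le W p hG []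

theorem RandomizedAlgorithm.meanLoad_append_of_not_adjacent (W : Finset S) (G₁ : Instance S)
    {G₂ : Instance S} (hG : ∀ r ∈ G₂, ∀ s ∈ W, r s = none) :
    A.meanLoad W (G₁ ++ G₂) = A.meanLoad W G₁ := by
  simp only [meanLoad, Policy.value_append, Policy.value_load_of_not_adjacent _ W hG]

theorem RandomizedAlgorithm.meanLoad_biUnion [Finite S] [DecidableEq S] {K : Type*}
    (t : Finset K) (W : K → Finset S) (hW : (t : Set K).PairwiseDisjoint W) (G : Instance S) :
    A.meanLoad (t.biUnion W) G = ∑ g ∈ t, A.meanLoad (W g) G := by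
  let := A.measurableSpace
  simp only [meanLoad]
  rw [← integral_finsetSum t fun g _ => A.integrable_value_load (W g) G]
  refine integral_congr_ae (Filter.Eventually.of_forall fun ω => ?_)
  simp only
  rw [← Policy.value_sum]
  congr 1
  funext h
  rw [load, Finset.sum_biUnion hW]
  push_cast
  simp [load]

end Randomized

/-! ### Lower bound for a truncated binomial mean. -/

section TruncatedMean

/-- The expectation of `min (x + B) M` for `x ≤ M` and a binomial variable `B` with `n` trials of
success probability `p`. -/
noncomputable def truncatedMean (M : ℕ) (p : ℝ) : ℕ → ℕ → ℝ
  | 0, x => x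
  | n + 1, x =>
    if x < M then p * truncatedMean M p n (x + 1) + (1 - p) * truncatedMean M p n x else x

theorem truncatedMean_of_le {M x : ℕ} (p : ℝ) (n : ℕ) (hx : M ≤ x) :
    truncatedMean M p n x = x := by
  cases n <;> simp [truncatedMean, hx]

/-- For every real `y`, `min y M ≥ y - (y - M + a) ^ 2 / (4 * a)`, because `(d + a) ^ 2 ≥ 4 * a *
d`. The left side of the bound is the expectation of this quadratic minorant at `y = x + B` with `B`
binomial, by mean and variance. -/
theorem le_truncatedMean {M : ℕ} {p a : ℝ} (hp : 0 ≤ p) (hp' : p ≤ 1) (ha : 0 < a) (n x : ℕ)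
    (hx : x ≤ M) :
    (x + n * p) - ((x + n * p - M + a) ^ 2 + n * p * (1 - p)) / (4 * a) ≤
      truncatedMean M p n x := by
  have hq : 0 ≤ 1 - p := sub_nonneg.2 hp'
  induction n generalizing x with
  | zero =>
    simp only [truncatedMean, Nat.cast_zero, zero_mul, add_zero, sub_le_self_iff]
    positivity
  | succ n ih =>
    rcases hx.lt_or_eq with hlt | rfl
    · rw [truncatedMean, if_pos hlt]
      -- The expected quadratic satisfies the one-trial recursion exactly, so this comparison is an
      -- equality.
      refine le_trans (le_of_eq ?_) (add_le_add
        (mul_le_mul_of_nonneg_left (ih (x + 1) hlt) hp) (mul_le_mul_of_nonneg_left (ih x hx) hq))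
      push_cast
      field_simp
      ring
    · rw [truncatedMean_of_le p _ le_rfl]
      have hν : 0 ≤ ((n + 1 : ℕ) : ℝ) * p := by positivity
      generalize ((n + 1 : ℕ) : ℝ) * p = ν at hν ⊢
      have : ν ≤ ((x + ν - x + a) ^ 2 + ν * (1 - p)) / (4 * a) := by
        rw [le_div_iff₀ (by positivity)]
        nlinarith [sq_nonneg (ν - a), mul_nonneg hν hq]
      linarith

theorem le_truncatedMean_floor {M : ℕ} (hM : 0 < M) {p : ℝ} (hp : 0 < p) (hp' : p ≤ 1) :
    M - 1 - √M / 2 ≤ truncatedMean M p ⌊M / p⌋₊ 0 := by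
  have hMr : (0 : ℝ) < M := by exact_mod_cast hM
  have ha : 0 < √(M : ℝ) := Real.sqrt_pos.2 hMr
  have ha1 : 1 ≤ √(M : ℝ) := Real.one_le_sqrt.2 (by exact_mod_cast hM)
  refine le_trans ?_ (le_truncatedMean hp.le hp' ha ⌊M / p⌋₊ 0 hM.le)
  have h1 : (⌊M / p⌋₊ : ℝ) * p ≤ M :=
    (le_div_iff₀ hp).1 (Nat.floor_le (by positivity))
  have h2 : M - 1 ≤ (⌊M / p⌋₊ : ℝ) * p := by
    have := (div_lt_iff₀ hp).1 (Nat.lt_floor_add_one (M / p))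
    linarith
  have h0 : 0 ≤ (⌊M / p⌋₊ : ℝ) * p := by positivity
  generalize (⌊M / p⌋₊ : ℝ) * p = ν at h0 h1 h2
  -- With `a = √M`, the bounds `M - 1 ≤ ν ≤ M` and `√M ≥ 1` put `ν - M + √M` in `[0, √M]`, so both
  -- summands of the numerator are at most `M`.
  have h3 : (((0 : ℕ) + ν - M + √M) ^ 2 + ν * (1 - p)) / (4 * √M) ≤ √M / 2 := by
    rw [div_le_iff₀ (by positivity)]
    have hs : √(M : ℝ) * √M = M := Real.mul_self_sqrt hMr.le
    have h4 : ((0 : ℕ) + ν - M + √(M : ℝ)) ^ 2 ≤ √(M : ℝ) ^ 2 := by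
      apply pow_le_pow_left₀ <;> push_cast <;> linarith
    have h5 : ν * (1 - p) ≤ M := (mul_le_of_le_one_right h0 (by linarith)).trans h1
    nlinarith
  push_cast at h3 ⊢
  linarith

end TruncatedMean

/-! ### The clairvoyant policy. -/

section TargetPolicy

variable {S K : Type}

open Classical in
/-- The policy that serves the `i`-th request by a server of the group `T[i]` with remaining
capacity, if there is one. -/
noncomputable def targetPolicy (grp : S → K) (b : ℕ) (T : List K) : Policy S b where
  choose h r :=
    if hx : ∃ s, T[h.length]? = some (grp s) ∧ r s ≠ none ∧ matchesOf h s < b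
    then some hx.choose else none
  feasible h r s hs := by
    split_ifs at hs with hx
    obtain rfl := Option.some.inj hs
    exact hx.choose_spec.2

theorem grp_of_targetPolicy_choose {grp : S → K} {b : ℕ} {T : List K} {h : History S} {r : Request S} {s : S}
    (hs : (targetPolicy grp b T).choose h r = some s) : T[h.length]? = some (grp s) := by
  simp only [targetPolicy] at hs
  split_ifs at hs with hx
  obtain rfl := Option.some.inj hs
  exact hx.choose_spec.1

end TargetPolicy

/-! ### The phased instances and the benchmark's value on them. -/

section Phases

variable {S K : Type} [DecidableEq K] (grp : S → K)

/-- A request that is adjacent to the servers of the groups in `U`. -/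
def groupRequest (p : unitInterval) (U : Finset K) : Request S :=
  fun s => if grp s ∈ U then some p else none

/-- Phases of `N` equal requests each. The first phase is adjacent to the groups in `U`, and after
each phase the next group in the list is dropped. -/
def phases (p : unitInterval) (N : ℕ) : Finset K → List K → Instance S
  | _, [] => []
  | U, g :: l => List.replicate N (groupRequest grp p U) ++ phases p N (U.erase g) l

theorem phases_append (p : unitInterval) (N : ℕ) (U : Finset K) (l₁ l₂ : List K) :
    phases grp p N U (l₁ ++ l₂) =
      phases grp p N U l₁ ++ phases grp p N (U \ l₁.toFinset) l₂ := by
  induction l₁ generalizing U with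
  | nil => simp [phases]
  | cons g l ih =>
    have : U \ (g :: l).toFinset = U.erase g \ l.toFinset := by
      ext x
      simp only [List.toFinset_cons, Finset.mem_sdiff, Finset.mem_insert, Finset.mem_erase]
      tauto
    rw [List.cons_append, phases, ih, phases, List.append_assoc, this]

theorem length_phases (p : unitInterval) (N : ℕ) (U : Finset K) (l : List K) :
    (phases grp p N U l).length = l.length * N := by
  induction l generalizing U with
  | nil => simp [phases]
  | cons g l ih => rw [phases, List.length_append, ih, List.length_replicate, List.length_cons]; ring

theorem exists_subset_of_mem_phases {p : unitInterval} {N : ℕ} {U : Finset K} {l : List K}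
    {r : Request S} (hr : r ∈ phases grp p N U l) : ∃ U' ⊆ U, r = groupRequest grp p U' := by
  induction l generalizing U with
  | nil => simp [phases] at hr
  | cons g l ih =>
    rw [phases, List.mem_append] at hr
    rcases hr with hr | hr
    · exact ⟨U, subset_rfl, List.eq_of_mem_replicate hr⟩
    · obtain ⟨U', hU', h⟩ := ih hr
      exact ⟨U', hU'.trans (Finset.erase_subset _ _), h⟩

theorem phases_mem_equalProbability (p : unitInterval) (N : ℕ) (U : Finset K) (l : List K) :
    phases grp p N U l ∈ equalProbability S p := by
  intro r hr s q hq
  obtain ⟨U', -, rfl⟩ := exists_subset_of_mem_phases grp hr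
  rw [groupRequest] at hq
  split_ifs at hq
  exact (Option.some.inj hq).symm

theorem eq_none_of_mem_phases {p : unitInterval} {N : ℕ} {U : Finset K} {l : List K}
    {r : Request S} (hr : r ∈ phases grp p N U l) {s : S} (hs : grp s ∉ U) : r s = none := by
  obtain ⟨U', hsub, rfl⟩ := exists_subset_of_mem_phases grp hr
  exact if_neg fun h => hs (hsub h)

/-- The servers of a group. -/
def members [Fintype S] (g : K) : Finset S := {s | grp s = g}

theorem mem_members [Fintype S] {g : K} {s : S} : s ∈ members grp g ↔ grp s = g := by
  simp [members]

variable {grp}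

theorem le_load_of_targetPolicy_choose [Fintype S] {b : ℕ} {T : List K} {h : History S}
    {r : Request S} {g : K} (hT : T[h.length]? = some g) (hr : ∀ s, grp s = g → r s ≠ none)
    (hs : (targetPolicy grp b T).choose h r = none) :
    (members grp g).card * b ≤ load (members grp g) h := by
  simp only [targetPolicy] at hs
  split_ifs at hs with hx
  push Not at hx
  refine Finset.card_nsmul_le_sum _ _ _ fun s hsg => ?_
  rw [mem_members] at hsg
  exact hx s (by rw [hT, hsg]) (hr s hsg)

/-- One phase aimed at `g`, on top of a gain `C` guaranteed by the rest `G`. The guarantee `hG` may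
assume that the groups in `l` are still empty, since the phase loads only `g`. The load of `g`
performs the walk behind `truncatedMean`: the policy leaves a request unassigned only when `g` is
full. The prefix `pre` keeps the position in `T` equal to the length of the history. -/
theorem add_truncatedMean_le_value_targetPolicy [Fintype S] {b M : ℕ} (p : unitInterval)
    {T : List K} {g : K} (hM : (members grp g).card * b = M) {r : Request S}
    (hr : ∀ s, grp s = g → r s = some p) {l : List K} (hg : g ∉ l) {G : Instance S} {C : ℝ}
    {T' : List K}
    (hG : ∀ h pre, T = pre ++ T' → h.length = pre.length →
      (∀ g' ∈ l, load (members grp g') h = 0) →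
      load Finset.univ h + C ≤
        (targetPolicy grp b T).value (fun h => (load Finset.univ h : ℝ)) h G)
    (n : ℕ) (h : History S) (pre : List K) (hT : T = pre ++ (List.replicate n g ++ T'))
    (hpre : h.length = pre.length) (hl : ∀ g' ∈ l, load (members grp g') h = 0) :
    load Finset.univ h + C +
        (truncatedMean M p n (load (members grp g) h) - load (members grp g) h) ≤
      (targetPolicy grp b T).value (fun h => (load Finset.univ h : ℝ)) h
        (List.replicate n r ++ G) := by
  induction n generalizing h pre with
  | zero =>
    have := hG h pre (by simpa using hT) hpre hl
    simpa [truncatedMean] using this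
  | succ n ih =>
    have hTg : T[h.length]? = some g := by
      rw [hT, hpre]
      simp [List.replicate_succ]
    have hT' : T = (pre ++ [g]) ++ (List.replicate n g ++ T') := by
      rw [hT, List.replicate_succ]
      simp
    rw [List.replicate_succ, List.cons_append]
    cases hc : (targetPolicy grp b T).choose h r with
    | none =>
      have hfull := le_load_of_targetPolicy_choose hTg (fun s hs => by simp [hr s hs]) hc
      rw [hM] at hfull
      have := ih (⟨r, none⟩ :: h) (pre ++ [g]) hT' (by simp [hpre])
        (by simpa [load_cons_none] using hl)
      rw [load_cons_none, load_cons_none, truncatedMean_of_le _ _ hfull] at this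
      rw [Policy.value_cons_none _ _ hc, truncatedMean_of_le _ _ hfull]
      exact this
    | some s =>
      have hs : grp s = g := by
        have := grp_of_targetPolicy_choose hc
        rw [hTg] at this
        exact (Option.some.inj this).symm
      have h1 := ih (⟨r, some (s, true)⟩ :: h) (pre ++ [g]) hT' (by simp [hpre]) (by
        intro g' hg'
        rw [load_cons_true, hl g' hg', if_neg]
        rw [mem_members, hs]
        rintro rfl
        exact hg hg')
      have h2 := ih (⟨r, some (s, false)⟩ :: h) (pre ++ [g]) hT' (by simp [hpre])
        (by simpa [load_cons_false] using hl)
      rw [load_cons_true, load_cons_true, if_pos (Finset.mem_univ _),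
        if_pos ((mem_members grp).2 hs)] at h1
      rw [load_cons_false, load_cons_false] at h2
      rw [Policy.value_cons_some _ _ hc (hr s hs)]
      have h3 := mul_le_mul_of_nonneg_left h1 p.2.1
      have h4 := mul_le_mul_of_nonneg_left h2 (sub_nonneg.2 p.2.2)
      have h5 : truncatedMean M p (n + 1) (load (members grp g) h) ≤
          p * truncatedMean M p n (load (members grp g) h + 1) +
            (1 - p) * truncatedMean M p n (load (members grp g) h) := by
        rw [truncatedMean]
        split_ifs with hlt
        · exact le_rfl
        · rw [not_lt] at hlt
          rw [truncatedMean_of_le _ _ hlt, truncatedMean_of_le _ _ (hlt.trans (Nat.le_succ _))]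
          push_cast
          linarith [p.2.1]
      push_cast at h3
      linarith

theorem length_mul_truncatedMean_le_value_targetPolicy [Fintype S] {b M : ℕ} (N : ℕ)
    (p : unitInterval) (hM : ∀ g, (members grp g).card * b = M) {T : List K} (l : List K)
    (hl : l.Nodup) (U : Finset K) (hU : ∀ g ∈ l, g ∈ U) (h : History S) (pre : List K)
    (hT : T = pre ++ l.flatMap (List.replicate N)) (hpre : h.length = pre.length)
    (hzero : ∀ g ∈ l, load (members grp g) h = 0) :
    load Finset.univ h + l.length * truncatedMean M p N 0 ≤
      (targetPolicy grp b T).value (fun h => (load Finset.univ h : ℝ)) h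
        (phases grp p N U l) := by
  induction l generalizing U h pre with
  | nil => simp [phases, Policy.value]
  | cons g l ih =>
    have hnd := List.nodup_cons.1 hl
    have key := add_truncatedMean_le_value_targetPolicy p (hM g)
      (r := groupRequest grp p U)
      (fun s hs => if_pos (hs ▸ hU g List.mem_cons_self)) hnd.1
      (G := phases grp p N (U.erase g) l) (T' := l.flatMap (List.replicate N))
      (fun h' pre' hT' hpre' hz' => ih hnd.2 (U.erase g)
        (fun g' hg' => Finset.mem_erase.2
          ⟨fun he => hnd.1 (he ▸ hg'), hU g' (List.mem_cons_of_mem _ hg')⟩) h' pre' hT' hpre' hz')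
      N h pre (by simpa using hT) hpre (fun g' hg' => hzero g' (List.mem_cons_of_mem _ hg'))
    rw [hzero g List.mem_cons_self] at key
    rw [phases, List.length_cons]
    push_cast at key ⊢
    linarith

theorem length_mul_truncatedMean_le_SOpt [Fintype S] {b M : ℕ} (N : ℕ)
    (p : unitInterval) (hM : ∀ g, (members grp g).card * b = M) (l : List K)
    (hl : l.Nodup) (U : Finset K) (hU : ∀ g ∈ l, g ∈ U) :
    ENNReal.ofReal (l.length * truncatedMean M p N 0) ≤ SOpt b (phases grp p N U l) := by
  refine le_trans ?_ (le_iSup _ (targetPolicy grp b (l.flatMap (List.replicate N))))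
  rw [Policy.expectedMatches_eq_ofReal_value]
  refine ENNReal.ofReal_le_ofReal ?_
  have := length_mul_truncatedMean_le_value_targetPolicy N p hM l hl U hU [] [] rfl rfl
    (fun g _ => load_nil _)
  simpa [load_nil] using this

end Phases

/-! ### The adversary that drops a least loaded group. -/

section Adversary

variable {S K : Type} [Fintype S] [Fintype K] [DecidableEq K] {grp : S → K} {b : ℕ}

theorem RandomizedAlgorithm.sum_meanLoad_members (A : RandomizedAlgorithm.{u} S b)
    (G : Instance S) :
    ∑ g, A.meanLoad (members grp g) G = A.meanLoad Finset.univ G := by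
  classical
  rw [← A.meanLoad_biUnion]
  · congr
    ext s
    simp [mem_members]
  · intro g _ g' _ hne
    refine Finset.disjoint_left.2 fun s hs hs' => hne ?_
    rw [mem_members] at hs hs'
    exact hs.symm.trans hs'

theorem RandomizedAlgorithm.meanLoad_members_phases_append (A : RandomizedAlgorithm.{u} S b)
    (p : unitInterval) (N : ℕ) {l : List K} {g : K} (hg : g ∈ l) (l' : List K) :
    A.meanLoad (members grp g) (phases grp p N Finset.univ (l ++ l')) =
      A.meanLoad (members grp g) (phases grp p N Finset.univ l) := by
  rw [phases_append]
  refine A.meanLoad_append_of_not_adjacent _ _ fun r hr s hs => eq_none_of_mem_phases grp hr ?_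
  rw [mem_members] at hs
  simpa [hs] using hg

/-- The bound is attained by even spreading: the `t` phases bring `M * t`, of which each of the `k -
t` remaining groups holds `M * ∑ j < t, 1 / (k - j)`. Dropping a group of least load keeps any other
strategy below it, as the minimum is at most the average over the groups present. -/
theorem RandomizedAlgorithm.exists_phases_sum_meanLoad_le (A : RandomizedAlgorithm.{u} S b)
    {p : unitInterval} {M N : ℕ} (hN : N * (p : ℝ) ≤ M) (t : ℕ) (ht : t ≤ Fintype.card K) :
    ∃ l : List K, l.Nodup ∧ l.length = t ∧
      ∑ g ∈ l.toFinset, A.meanLoad (members grp g) (phases grp p N Finset.univ l) ≤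
        M * (t - (Fintype.card K - t) *
          ∑ j ∈ Finset.range t, 1 / ((Fintype.card K : ℝ) - j)) := by
  set k := Fintype.card K with hk
  induction t with
  | zero => exact ⟨[], by simp⟩
  | succ t ih =>
    obtain ⟨l, hnd, hlen, hD⟩ := ih (by omega)
    have hcard : (l.toFinset)ᶜ.card = k - t := by
      rw [Finset.card_compl, List.toFinset_card_of_nodup hnd, hlen]
    have hne : (l.toFinset)ᶜ.Nonempty := by
      rw [← Finset.card_pos]
      omega
    -- The requests of a phase do not depend on the group that is dropped after it.
    have hind : ∀ g g', phases grp p N Finset.univ (l ++ [g]) =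
        phases grp p N Finset.univ (l ++ [g']) := fun g g' => by
      simp [phases_append, phases]
    obtain ⟨g₀, hg₀⟩ := hne
    set G := phases grp p N Finset.univ (l ++ [g₀]) with hG
    obtain ⟨g, hg, hmin⟩ := Finset.exists_min_image (l.toFinset)ᶜ
      (fun g => A.meanLoad (members grp g) G) ⟨g₀, hg₀⟩
    have hgl : g ∉ l := by simpa using hg
    refine ⟨l ++ [g], ?_, by simp [hlen], ?_⟩
    · rw [List.nodup_append]
      exact ⟨hnd, by simp, by rintro a ha b hb rfl; exact hgl (by simp_all)⟩
    have hset : (l ++ [g]).toFinset = insert g l.toFinset := by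
      ext x
      simp
    have hold : ∑ g ∈ l.toFinset, A.meanLoad (members grp g) G =
        ∑ g ∈ l.toFinset, A.meanLoad (members grp g) (phases grp p N Finset.univ l) :=
      Finset.sum_congr rfl fun g' hg' =>
        A.meanLoad_members_phases_append p N (List.mem_toFinset.1 hg') _
    have htot : ∑ g, A.meanLoad (members grp g) G ≤ M * (t + 1) := by
      rw [A.sum_meanLoad_members]
      refine (A.meanLoad_le_length_mul _ (phases_mem_equalProbability grp p N _ _)).trans ?_
      rw [length_phases, List.length_append, hlen]
      push_cast [List.length_singleton]
      nlinarith [mul_le_mul_of_nonneg_left hN (by positivity : (0 : ℝ) ≤ t + 1)]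
    have hsplit := Finset.sum_add_sum_compl l.toFinset fun g => A.meanLoad (members grp g) G
    have hx := Finset.card_nsmul_le_sum _ _ _ hmin
    have hkt : ((k - t : ℕ) : ℝ) = k - t := Nat.cast_sub (by omega)
    rw [hcard, nsmul_eq_mul, hkt] at hx
    rw [hind g g₀, hset, Finset.sum_insert (by simpa using hgl), hold, Finset.sum_range_succ]
    rw [hold] at hsplit
    generalize A.meanLoad (members grp g) G = x at *
    generalize ∑ g ∈ l.toFinset,
      A.meanLoad (members grp g) (phases grp p N Finset.univ l) = D at *
    generalize ∑ j ∈ Finset.range t, 1 / ((k : ℝ) - j) = H at *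
    have hd : (1 : ℝ) ≤ k - t := by
      rw [← hkt]
      exact_mod_cast (by omega : 1 ≤ k - t)
    have hd0 : (0 : ℝ) < k - t := by linarith
    have hx' : x ≤ (M * (t + 1) - D) / (k - t) := by
      rw [le_div_iff₀ hd0]
      linarith
    -- After inserting the averaging bound for `x`, the old sum `D` enters with coefficient `1 - 1 /
    -- (k - t) ≥ 0`, so its upper bound may be substituted.
    have hD' := mul_le_mul_of_nonneg_right hD
      (div_nonneg (sub_nonneg.2 hd) hd0.le : (0 : ℝ) ≤ (k - t - 1) / (k - t))
    have e1 : (M * (t + 1) - D) / (k - t) + D =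
        D * ((k - t - 1) / (k - t)) + M * (t + 1) / (k - t) := by
      field_simp
      ring
    have e2 : M * (t - (k - t) * H) * ((k - t - 1) / (k - t)) + M * (t + 1) / (k - t) =
        M * ((t + 1 : ℕ) - (k - (t + 1 : ℕ)) * (H + 1 / (k - t))) := by
      push_cast
      field_simp
      ring
    linarith

/-- After `t` adversarial drops the remaining groups follow in arbitrary order, and only their
capacity `M` is used. -/
theorem RandomizedAlgorithm.exists_phases_meanLoad_le (A : RandomizedAlgorithm.{u} S b)
    {p : unitInterval} {M N : ℕ} (hN : N * (p : ℝ) ≤ M)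
    (hM : ∀ g, (members grp g).card * b = M) (t : ℕ) (ht : t ≤ Fintype.card K) :
    ∃ l : List K, l.Nodup ∧ l.length = Fintype.card K ∧
      A.meanLoad Finset.univ (phases grp p N Finset.univ l) ≤
        M * (Fintype.card K - (Fintype.card K - t) *
          ∑ j ∈ Finset.range t, 1 / ((Fintype.card K : ℝ) - j)) := by
  obtain ⟨l, hnd, hlen, hD⟩ := A.exists_phases_sum_meanLoad_le (grp := grp) hN t ht
  have hcard : (l.toFinset)ᶜ.card = Fintype.card K - t := by
    rw [Finset.card_compl, List.toFinset_card_of_nodup hnd, hlen]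
  refine ⟨l ++ (l.toFinset)ᶜ.toList, ?_, ?_, ?_⟩
  · rw [List.nodup_append]
    refine ⟨hnd, Finset.nodup_toList _, ?_⟩
    rintro a ha c hc rfl
    simp [ha] at hc
  · rw [List.length_append, Finset.length_toList, hcard, hlen]
    omega
  · rw [← A.sum_meanLoad_members (grp := grp), ← Finset.sum_add_sum_compl l.toFinset]
    have h1 : ∑ g ∈ l.toFinset, A.meanLoad (members grp g)
        (phases grp p N Finset.univ (l ++ (l.toFinset)ᶜ.toList)) =
        ∑ g ∈ l.toFinset, A.meanLoad (members grp g) (phases grp p N Finset.univ l) :=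
      Finset.sum_congr rfl fun g' hg' =>
        A.meanLoad_members_phases_append p N (List.mem_toFinset.1 hg') _
    have h2 : ∑ g ∈ (l.toFinset)ᶜ, A.meanLoad (members grp g)
        (phases grp p N Finset.univ (l ++ (l.toFinset)ᶜ.toList)) ≤
        (l.toFinset)ᶜ.card • (M : ℝ) := by
      refine Finset.sum_le_card_nsmul _ _ _ fun g _ => (A.meanLoad_le_card_mul _ _).trans ?_
      exact_mod_cast (hM g).le
    rw [hcard, nsmul_eq_mul, Nat.cast_sub ht] at h2
    rw [h1]
    linarith

end Adversary

/-! ### Choice of the number of groups and of their size. -/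

section Parameters

/-- Telescoping of `log (1 + 1 / d) ≤ 1 / d`. The shift by one in the logarithm keeps the case `t =
k` meaningful. -/
theorem log_div_le_sum_one_div_sub {k t : ℕ} (ht : t ≤ k) :
    Real.log ((k + 1) / (k - t + 1)) ≤ ∑ j ∈ Finset.range t, 1 / ((k : ℝ) - j) := by
  induction t with
  | zero =>
    have : (k : ℝ) + 1 ≠ 0 := by positivity
    simp [this]
  | succ t ih =>
    have hd : (0 : ℝ) < k - t := sub_pos.2 (by exact_mod_cast ht)
    rw [Finset.sum_range_succ]
    have h1 := ih (by omega)
    have h2 := Real.log_le_sub_one_of_pos (by positivity : 0 < ((k : ℝ) - t + 1) / (k - t))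
    have h3 : ((k : ℝ) - t + 1) / (k - t) - 1 = 1 / (k - t) := by
      field_simp
      ring
    have h4 : Real.log ((k + 1) / (k - (t + 1 : ℕ) + 1)) =
        Real.log ((k + 1) / (k - t + 1)) + Real.log (((k : ℝ) - t + 1) / (k - t)) := by
      rw [← Real.log_mul (by positivity) (by positivity)]
      congr 1
      push_cast
      have : (k : ℝ) - (t + 1) + 1 = k - t := by ring
      rw [this]
      field_simp
    linarith

open Filter Topology in
theorem exists_sub_mul_sum_lt {c : ℝ} (hc : 1 - 1 / Real.exp 1 < c) :
    ∃ k t : ℕ, 0 < k ∧ t ≤ k ∧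
      k - (k - t) * ∑ j ∈ Finset.range t, 1 / ((k : ℝ) - j) < c * k := by
  set a : ℝ := 1 / Real.exp 1 with ha
  have ha0 : 0 < a := by positivity
  have ha1 : a ≤ 1 := by
    rw [ha, div_le_one (Real.exp_pos 1)]
    exact Real.one_le_exp zero_le_one
  have hinv : Tendsto (fun k : ℕ => 1 / (k : ℝ)) atTop (𝓝 0) :=
    tendsto_one_div_atTop_nhds_zero_nat
  have h1 : Tendsto (fun k : ℕ => (⌊a * k⌋₊ : ℝ) / k) atTop (𝓝 a) :=
    (tendsto_nat_floor_mul_div_atTop ha0.le).comp tendsto_natCast_atTop_atTop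
  have h2 : Tendsto (fun k : ℕ => (1 + 1 / (k : ℝ)) / ((⌊a * k⌋₊ : ℝ) / k + 1 / k)) atTop
      (𝓝 ((1 + 0) / (a + 0))) :=
    (tendsto_const_nhds.add hinv).div (h1.add hinv) (by simpa using ha0.ne')
  have h3 : Tendsto (fun k : ℕ => 1 - (⌊a * k⌋₊ : ℝ) / k *
      Real.log ((1 + 1 / (k : ℝ)) / ((⌊a * k⌋₊ : ℝ) / k + 1 / k))) atTop
      (𝓝 (1 - a * Real.log ((1 + 0) / (a + 0)))) :=
    tendsto_const_nhds.sub (h1.mul (h2.log (by simpa using ha0.ne')))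
  have h4 : 1 - a * Real.log ((1 + 0) / (a + 0)) = 1 - a := by
    simp [ha]
  rw [h4] at h3
  obtain ⟨k, hk, hk0⟩ := ((h3.eventually (gt_mem_nhds hc)).and (eventually_gt_atTop 0)).exists
  have hkr : (0 : ℝ) < k := by exact_mod_cast hk0
  have hfl : ⌊a * k⌋₊ ≤ k := Nat.floor_le_of_le (by nlinarith)
  -- About `k / e` groups remain after `t` drops; `x = 1 / e` maximizes `x * log (1 / x)`, with
  -- value `1 / e`.
  refine ⟨k, k - ⌊a * k⌋₊, hk0, Nat.sub_le _ _, ?_⟩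
  have hlog := log_div_le_sum_one_div_sub (Nat.sub_le k ⌊a * k⌋₊)
  have hcast : (k : ℝ) - ((k - ⌊a * k⌋₊ : ℕ) : ℝ) = ⌊a * k⌋₊ := by
    rw [Nat.cast_sub hfl]
    ring
  rw [hcast] at hlog ⊢
  have harg : (1 + 1 / (k : ℝ)) / ((⌊a * k⌋₊ : ℝ) / k + 1 / k) =
      (k + 1) / (⌊a * k⌋₊ + 1) := by
    field_simp
  rw [harg] at hk
  have hmul := mul_le_mul_of_nonneg_left hlog (Nat.cast_nonneg ⌊a * k⌋₊)
  have hk' := mul_lt_mul_of_pos_right hk hkr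
  have e : (1 - (⌊a * k⌋₊ : ℝ) / k * Real.log ((k + 1) / (⌊a * k⌋₊ + 1))) * k =
      k - ⌊a * k⌋₊ * Real.log ((k + 1) / (⌊a * k⌋₊ + 1)) := by
    field_simp
  linarith

-- Here `c'` stands for the limiting ratio obtained from `k` and `t`; the slack `c - c'` absorbs the
-- truncation loss once `m * b` is large.
open Filter Topology in
theorem exists_mul_lt_mul_sub_sqrt {b : ℕ} (hb : 1 ≤ b) {c' c : ℝ} (hc : c' < c) :
    ∃ m : ℕ, 0 < m ∧
      ((m * b : ℕ) : ℝ) * c' < c * (((m * b : ℕ) : ℝ) - 1 - √((m * b : ℕ) : ℝ) / 2) := by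
  have hM : Tendsto (fun m : ℕ => ((m * b : ℕ) : ℝ)) atTop atTop :=
    tendsto_natCast_atTop_atTop.comp (tendsto_id.atTop_mul_const' (by omega))
  have h1 : Tendsto (fun x : ℝ => c * (1 - x⁻¹ - (√x)⁻¹ / 2)) atTop
      (𝓝 (c * (1 - 0 - 0 / 2))) :=
    ((tendsto_const_nhds.sub tendsto_inv_atTop_zero).sub
      ((tendsto_inv_atTop_zero.comp Real.tendsto_sqrt_atTop).div_const 2)).const_mul c
  have h2 := (h1.comp hM).eventually (lt_mem_nhds (by simpa using hc))
  obtain ⟨m, hm, hm0⟩ := (h2.and (eventually_gt_atTop 0)).exists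
  refine ⟨m, hm0, ?_⟩
  have hpos : (0 : ℝ) < ((m * b : ℕ) : ℝ) := by
    exact_mod_cast Nat.mul_pos hm0 (by omega)
  simp only [Function.comp_apply] at hm
  generalize ((m * b : ℕ) : ℝ) = x at hm hpos ⊢
  have hs : 0 < √x := Real.sqrt_pos.2 hpos
  have hs' : x * (√x)⁻¹ = √x := by
    rw [← div_eq_mul_inv, Real.div_sqrt]
  have h3 := mul_lt_mul_of_pos_left hm hpos
  have h4 : x * (c * (1 - x⁻¹ - (√x)⁻¹ / 2)) = c * (x - x * x⁻¹ - x * (√x)⁻¹ / 2) := by ring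
  rw [h4, hs', mul_inv_cancel₀ hpos.ne'] at h3
  exact h3

end Parameters

/-! ### Assembly of the two bounds. -/

theorem RandomizedAlgorithm.not_isCompetitiveOn_of_groups {S K : Type} [Fintype S] [Fintype K]
    [DecidableEq K] {grp : S → K} {b M : ℕ} (hM0 : 0 < M)
    (hM : ∀ g, (members grp g).card * b = M) {t : ℕ} (ht : t ≤ Fintype.card K) {c : ℝ}
    (hc0 : 0 ≤ c)
    (hlt : M * (Fintype.card K - (Fintype.card K - t) *
      ∑ j ∈ Finset.range t, 1 / ((Fintype.card K : ℝ) - j)) <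
        c * (Fintype.card K * (M - 1 - √M / 2)))
    {p : unitInterval} (hp : 0 < (p : ℝ)) (A : RandomizedAlgorithm.{u} S b) :
    ¬ A.IsCompetitiveOn c (equalProbability S p) := by
  intro hA
  have hN : (⌊M / (p : ℝ)⌋₊ : ℝ) * p ≤ M :=
    (le_div_iff₀ hp).1 (Nat.floor_le (by positivity))
  obtain ⟨l, hnd, hlen, hle⟩ := A.exists_phases_meanLoad_le (grp := grp) hN hM t ht
  have h1 := hA _ (phases_mem_equalProbability grp p ⌊M / (p : ℝ)⌋₊ Finset.univ l)
  have h2 := length_mul_truncatedMean_le_SOpt ⌊M / (p : ℝ)⌋₊ p hM l hnd Finset.univ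
    (fun g _ => Finset.mem_univ g)
  have h3 : ENNReal.ofReal (c * (l.length * truncatedMean M p ⌊M / (p : ℝ)⌋₊ 0)) ≤
      ENNReal.ofReal (A.meanLoad Finset.univ
        (phases grp p ⌊M / (p : ℝ)⌋₊ Finset.univ l)) := by
    rw [ENNReal.ofReal_mul hc0, ← A.expectedMatches_eq_ofReal_meanLoad]
    exact (mul_le_mul_right h2 _).trans h1
  rw [ENNReal.ofReal_le_ofReal_iff (A.meanLoad_nonneg _ _), hlen] at h3
  have h4 : c * (Fintype.card K * (M - 1 - √M / 2)) ≤
      c * (Fintype.card K * truncatedMean M p ⌊M / (p : ℝ)⌋₊ 0) := by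
    gcongr
    exact le_truncatedMean_floor hM0 hp p.2.2
  linarith

theorem card_members_finProdFinEquiv (k m : ℕ) (g : Fin k) :
    (members (fun s : Fin (k * m) => (finProdFinEquiv.symm s).1) g).card = m := by
  have : members (fun s : Fin (k * m) => (finProdFinEquiv.symm s).1) g =
      (Finset.univ : Finset (Fin m)).map
        ⟨fun i => finProdFinEquiv (g, i), fun i j hij => by simpa using hij⟩ := by
    ext s
    obtain ⟨⟨g', i⟩, rfl⟩ := finProdFinEquiv.surjective s
    rw [mem_members, Equiv.symm_apply_apply, Finset.mem_map]
    constructor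
    · rintro rfl
      exact ⟨i, Finset.mem_univ i, rfl⟩
    · rintro ⟨j, -, hj⟩
      exact (congrArg Prod.fst (finProdFinEquiv.injective hj)).symm
  rw [this, Finset.card_map, Finset.card_univ, Fintype.card_fin]

end StochasticBMatching

open StochasticBMatching in
/-- For every capacity `b ≥ 1` and every `c > 1 - 1/e` there is a number `n` of servers such that,
for all sufficiently small `p > 0`, no randomized online algorithm, even one tailored to `n`, `b`
and `p`, is `c`-competitive against the stochastic benchmark on the graphs with `n` servers and all
edge probabilities equal to `p`. -/
theorem mainTheorem1 (b : ℕ) (hb : 1 ≤ b) (c : ℝ) (hc : 1 - 1 / Real.exp 1 < c) :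
    ∃ n : ℕ, ∃ p₀ : ℝ, 0 < p₀ ∧
      ∀ p : unitInterval, 0 < (p : ℝ) → (p : ℝ) ≤ p₀ →
        ∀ A : RandomizedAlgorithm.{u} (Fin n) b,
          ¬ A.IsCompetitiveOn c (equalProbability (Fin n) p) := by
  obtain ⟨k, t, hk, htk, hkt⟩ := exists_sub_mul_sum_lt hc
  have hkr : (0 : ℝ) < k := by exact_mod_cast hk
  obtain ⟨m, hm, hmc⟩ := exists_mul_lt_mul_sub_sqrt hb ((div_lt_iff₀ hkr).2 hkt)
  have hc0 : 0 ≤ c := by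
    refine le_trans (sub_nonneg.2 ?_) hc.le
    rw [div_le_one (Real.exp_pos 1)]
    exact Real.one_le_exp zero_le_one
  -- The choice `p₀ = 1` works: the truncation bound is uniform in `p`, so `k` and `m` do not depend
  -- on it.
  refine ⟨k * m, 1, one_pos, fun p hp _ A => ?_⟩
  refine A.not_isCompetitiveOn_of_groups (K := Fin k) (M := m * b) (t := t)
    (grp := fun s => (finProdFinEquiv.symm s).1) (Nat.mul_pos hm (by omega))
    (fun g => by rw [card_members_finProdFinEquiv]) (by simpa using htk) hc0 ?_ hp
  rw [Fintype.card_fin]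
  rw [← mul_div_assoc, div_lt_iff₀ hkr] at hmc
  linarith
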